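/- Let $\Omega\subset\mathbb{R}^n$ be a bounded, open, strictly convex domain (its boundary contains no line segment) with $C^\infty$ boundary and outward unit normal $\nu$, and let $V\in C^\infty(\bar\Omega)$ be real-valued. Let $u_0,u_1\in C^\infty(\bar\Omega\times[0,\infty))$ be real-valued solutions of the Dirichlet problem $$\frac{\partial u}{\partial t}=\Delta u-Vu\ \text{ on }\Omega\times[0,\infty),\qquad u=0\ \text{ on }\partial\Omega\times[0,\infty),$$ with $u_0>0$ on $\Omega\times[0,\infty)$. Then $v=u_1/u_0$ is smooth on $\Omega\times[0,\infty)$ and satisfies $$\frac{\partial v}{\partial t}-\Delta v-2\nabla\log u_0\cdot\nabla v=0\quad\text{on }\Omega\times[0,\infty).$$ Moreover, $v$ extends to a smooth function on $\bar\Omega\times(0,\infty)$ with $D_\nu v=0$ on $\partial\Omega\times(0,\infty)$. If in addition $\nabla u_0(x,0)\neq 0$ for every $x\in\partial\Omega$, then $v$ extends to a smooth function on $\bar\Omega\times[0,\infty)$ with $D_\nu v=0$ on $\partial\Omega\times[0,\infty)$. (Here smoothness and derivatives at boundary points and at $t=0$ are one-sided.) -/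

import Mathlib

open Set
open scoped ContDiff Laplacian

/-- `ρ` is a smooth local defining function of the open set `Ω` on the open neighbourhood `U`
of the point `p`. -/
structure IsLocalDefiningFunction {n : ℕ} (Ω : Set (EuclideanSpace ℝ (Fin n)))
    (p : EuclideanSpace ℝ (Fin n)) (U : Set (EuclideanSpace ℝ (Fin n)))
    (ρ : EuclideanSpace ℝ (Fin n) → ℝ) : Prop where
  isOpen : IsOpen U
  mem : p ∈ U
  smooth : ContDiffOn ℝ ∞ ρ U
  gradient_ne_zero : gradient ρ p ≠ 0
  inter_eq : Ω ∩ U = {x ∈ U | ρ x < 0}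

/-- `Ω` lies locally on one side of its boundary, which is a smooth hypersurface. -/
def HasSmoothBoundary {n : ℕ} (Ω : Set (EuclideanSpace ℝ (Fin n))) : Prop :=
  ∀ p ∈ frontier Ω, ∃ U ρ, IsLocalDefiningFunction Ω p U ρ

/-- `ν` is the outward unit normal of `∂Ω` at `p`: the normalized gradient of a local defining
function which is negative inside `Ω`. -/
def IsOuterUnitNormal {n : ℕ} (Ω : Set (EuclideanSpace ℝ (Fin n)))
    (p ν : EuclideanSpace ℝ (Fin n)) : Prop :=
  ‖ν‖ = 1 ∧ ∃ U ρ, IsLocalDefiningFunction Ω p U ρ ∧ ∃ c : ℝ, 0 < c ∧ gradient ρ p = c • ν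

/-- A bounded strictly convex domain with smooth boundary. (For an open set, strict convexity in
the usual sense, that the boundary contains no segment, is strict convexity of the closure.) -/
structure IsSmoothStrictlyConvexDomain {n : ℕ} (Ω : Set (EuclideanSpace ℝ (Fin n))) : Prop where
  isOpen : IsOpen Ω
  nonempty : Ω.Nonempty
  isBounded : Bornology.IsBounded Ω
  convex : Convex ℝ Ω
  strictConvex_closure : StrictConvex ℝ (closure Ω)
  smoothBoundary : HasSmoothBoundary Ω

/-- The function `(x, t) ↦ u x t` is smooth on `S`, up to those boundary points that lie in `S`
(derivatives are taken within `S`). -/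
def SmoothOn {n : ℕ} (u : EuclideanSpace ℝ (Fin n) → ℝ → ℝ)
    (S : Set (EuclideanSpace ℝ (Fin n) × ℝ)) : Prop :=
  ContDiffOn ℝ ∞ (fun z : EuclideanSpace ℝ (Fin n) × ℝ => u z.1 z.2) S

/-- The time derivative `∂u/∂t` at `(x, t)`, `t ≥ 0`; it is one-sided at `t = 0`. -/
noncomputable def timeDeriv {n : ℕ} (u : EuclideanSpace ℝ (Fin n) → ℝ → ℝ)
    (x : EuclideanSpace ℝ (Fin n)) (t : ℝ) : ℝ :=
  derivWithin (fun s => u x s) (Ici 0) t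

/-- The spatial Laplacian at an interior point. -/
noncomputable def spaceLaplacian {n : ℕ} (u : EuclideanSpace ℝ (Fin n) → ℝ → ℝ)
    (x : EuclideanSpace ℝ (Fin n)) (t : ℝ) : ℝ :=
  Δ (fun y => u y t) x

/-- The spatial gradient at an interior point. -/
noncomputable def spaceGradient {n : ℕ} (u : EuclideanSpace ℝ (Fin n) → ℝ → ℝ)
    (x : EuclideanSpace ℝ (Fin n)) (t : ℝ) : EuclideanSpace ℝ (Fin n) :=
  gradient (fun y => u y t) x

/-- The spatial differential at a point of the closed domain, taken from within it. -/
noncomputable def spaceDifferential {n : ℕ} (Ω : Set (EuclideanSpace ℝ (Fin n)))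
    (u : EuclideanSpace ℝ (Fin n) → ℝ → ℝ) (x : EuclideanSpace ℝ (Fin n)) (t : ℝ) :
    EuclideanSpace ℝ (Fin n) →L[ℝ] ℝ :=
  fderivWithin ℝ (fun y => u y t) (closure Ω) x

/-- `u` is a smooth solution, up to the boundary and up to time `0`, of the Dirichlet problem
`∂u/∂t = Δu - V u` on `Ω × [0, ∞)`, `u = 0` on `∂Ω × [0, ∞)`. -/
structure IsSchrodingerSolution {n : ℕ} (Ω : Set (EuclideanSpace ℝ (Fin n)))
    (V : EuclideanSpace ℝ (Fin n) → ℝ) (u : EuclideanSpace ℝ (Fin n) → ℝ → ℝ) : Prop where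
  smooth : SmoothOn u (closure Ω ×ˢ Ici 0)
  equation : ∀ x ∈ Ω, ∀ t ≥ 0, timeDeriv u x t = spaceLaplacian u x t - V x * u x t
  dirichlet : ∀ x ∈ frontier Ω, ∀ t ≥ 0, u x t = 0

/-- On the time set `J`, the function `v` is smooth up to the boundary of `Ω` and its outward
normal derivative vanishes on the boundary. -/
structure IsSmoothNeumann {n : ℕ} (Ω : Set (EuclideanSpace ℝ (Fin n))) (J : Set ℝ)
    (v : EuclideanSpace ℝ (Fin n) → ℝ → ℝ) : Prop where
  smooth : SmoothOn v (closure Ω ×ˢ J)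
  neumann : ∀ x ∈ frontier Ω, ∀ t ∈ J, ∀ ν, IsOuterUnitNormal Ω x ν →
    spaceDifferential Ω v x t ν = 0

/-!
The quotient `v = u₁ / u₀` satisfies the asserted equation inside `Ω` by the product rule: inserting
`u₁ = v u₀` in the equation for `u₁` and subtracting `v` times the equation for `u₀` leaves
`u₀ (∂v/∂t - Δv) = 2 ⟨∇u₀, ∇v⟩` (`quotient_identity`), in which the potential has cancelled.

At the boundary both solutions vanish. Along a direction transversal to `∂Ω` at `p`, each `uᵢ` is
`-τ wᵢ`, where `τ x` is the (signed) displacement from `x` to `∂Ω` in that direction, smooth by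
the implicit function theorem (`IsLocalDefiningFunction.exists_transversal_projection`), and `wᵢ` is
the integral of a directional derivative of `uᵢ` over the segment from `x` to `∂Ω`
(`SmoothOn.exists_factor`). That segment stays in the closed domain by convexity, so `wᵢ` is smooth
up to the boundary. Hence `v = w₁ / w₀` near `(p, t)`, and this is smooth as soon as `w₀ p t ≠ 0`,
which holds exactly when the differential of `u₀` at `(p, t)` is nonzero.

For `t = 0` this is a hypothesis. For `t > 0` it is Hopf's lemma
(`IsSchrodingerSolution.spaceDifferential_ne_zero`): the solution is compared with a multiple of the
subsolution `q + A q²`, `q = -ρ - ‖x - p‖² - (t₀ - t)`, on the part of `{q ≥ 0}` near `(p, t₀)`,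
which touches `∂Ω` only at `(p, t₀)`; no interior ball is needed.

The Neumann condition follows from the identity above: at a boundary point the left side vanishes,
so `⟨∇u₀, ∇v⟩ = 0`, and `∇u₀` is a nonzero multiple of the normal because `u₀` is positive inside and
zero on the boundary (`IsOuterUnitNormal.exists_eq_smul_innerSL`).
-/

open Filter Topology MeasureTheory

/-! ### Integrals over `[0, 1]` depending smoothly on a parameter -/

universe u

lemma continuousOn_intervalIntegral_of_prod {E F : Type*} [TopologicalSpace E]
    [NormedAddCommGroup F] [NormedSpace ℝ F] {K : Set E} {g : E × ℝ → F}
    (hg : ContinuousOn g (K ×ˢ Icc 0 1)) :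
    ContinuousOn (fun x => ∫ s in (0 : ℝ)..1, g (x, s)) K := by
  intro x₀ hx₀
  rw [ContinuousWithinAt, Metric.tendsto_nhds]
  intro ε hε
  obtain ⟨v, hv, hvu⟩ := isCompact_Icc.mem_uniformity_of_prod (f := fun x s => g (x, s)) hg hx₀
    (Metric.dist_mem_uniformity (half_pos hε))
  have hint : ∀ x ∈ K, IntervalIntegrable (fun s => g (x, s)) volume 0 1 := fun x hx =>
    ContinuousOn.intervalIntegrable_of_Icc zero_le_one
      (hg.comp (by fun_prop) fun s hs => ⟨hx, hs⟩)
  filter_upwards [hv, self_mem_nhdsWithin] with x hx hxK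
  rw [dist_eq_norm, ← intervalIntegral.integral_sub (hint x hxK) (hint x₀ hx₀)]
  refine lt_of_le_of_lt (intervalIntegral.norm_integral_le_of_norm_le_const (C := ε / 2) ?_) ?_
  · intro s hs
    rw [uIoc_of_le zero_le_one] at hs
    have := hvu x hx s ⟨hs.1.le, hs.2⟩
    rw [← dist_eq_norm]
    exact this.le
  · norm_num; exact hε

/-- Differentiation under the integral sign, up to the boundary of a convex parameter set. -/
lemma hasFDerivWithinAt_intervalIntegral_of_convex {E F : Type*} [NormedAddCommGroup E]
    [NormedSpace ℝ E] [NormedAddCommGroup F] [NormedSpace ℝ F] [CompleteSpace F]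
    {K : Set E} (hK : Convex ℝ K) {g : E × ℝ → F} {g' : E × ℝ → E →L[ℝ] F}
    (hg : ContinuousOn g (K ×ˢ Icc 0 1)) (hg' : ContinuousOn g' (K ×ˢ Icc 0 1))
    (hder : ∀ x ∈ K, ∀ s ∈ Icc (0 : ℝ) 1, HasFDerivWithinAt (fun y => g (y, s)) (g' (x, s)) K x)
    {x₀ : E} (hx₀ : x₀ ∈ K) :
    HasFDerivWithinAt (fun x => ∫ s in (0 : ℝ)..1, g (x, s))
      (∫ s in (0 : ℝ)..1, g' (x₀, s)) K x₀ := by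
  have hint : ∀ x ∈ K, IntervalIntegrable (fun s => g (x, s)) volume 0 1 := fun x hx =>
    ContinuousOn.intervalIntegrable_of_Icc zero_le_one
      (hg.comp (by fun_prop) fun s hs => ⟨hx, hs⟩)
  have hint' : IntervalIntegrable (fun s => g' (x₀, s)) volume 0 1 :=
    ContinuousOn.intervalIntegrable_of_Icc zero_le_one
      (hg'.comp (by fun_prop) fun s hs => ⟨hx₀, hs⟩)
  rw [hasFDerivWithinAt_iff_isLittleO, Asymptotics.isLittleO_iff]
  intro ε hε
  obtain ⟨v, hv, hvu⟩ := isCompact_Icc.mem_uniformity_of_prod (f := fun x s => g' (x, s)) hg' hx₀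
    (Metric.dist_mem_uniformity hε)
  obtain ⟨r, hr, hrv⟩ := Metric.mem_nhdsWithin_iff.1 hv
  filter_upwards [self_mem_nhdsWithin, inter_mem_nhdsWithin K (Metric.ball_mem_nhds x₀ hr)]
    with y hyK hy
  have hint'' : IntervalIntegrable (fun s => g' (x₀, s) (y - x₀)) volume 0 1 :=
    ⟨hint'.1.apply_continuousLinearMap _, hint'.2.apply_continuousLinearMap _⟩
  rw [ContinuousLinearMap.intervalIntegral_apply hint',
    ← intervalIntegral.integral_sub (hint y hyK) (hint x₀ hx₀),
    ← intervalIntegral.integral_sub ((hint y hyK).sub (hint x₀ hx₀)) hint'']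
  refine (intervalIntegral.norm_integral_le_of_norm_le_const (C := ε * ‖y - x₀‖) ?_).trans
    (by norm_num)
  intro s hs
  rw [uIoc_of_le zero_le_one] at hs
  have hs' : s ∈ Icc (0 : ℝ) 1 := ⟨hs.1.le, hs.2⟩
  refine Convex.norm_image_sub_le_of_norm_hasFDerivWithin_le' (𝕜 := ℝ) (f := fun z => g (z, s))
    (f' := fun z => g' (z, s)) (s := K ∩ Metric.ball x₀ r) (φ := g' (x₀, s))
    (fun z hz => (hder z hz.1 s hs').mono inter_subset_left) ?_
    (hK.inter (convex_ball x₀ r)) ⟨hx₀, Metric.mem_ball_self hr⟩ hy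
  intro z hz
  have := hvu z (hrv ⟨hz.2, hz.1⟩) s hs'
  rw [← dist_eq_norm]
  exact this.le

lemma contDiffOn_intervalIntegral_of_nat {E : Type u} [NormedAddCommGroup E] [NormedSpace ℝ E]
    {K : Set E} (hK : Convex ℝ K) (hKi : (interior K).Nonempty) (m : ℕ) :
    ∀ {F : Type u} [NormedAddCommGroup F] [NormedSpace ℝ F] [CompleteSpace F] {g : E × ℝ → F},
      ContDiffOn ℝ m g (K ×ˢ Icc 0 1) →
      ContDiffOn ℝ m (fun x => ∫ s in (0 : ℝ)..1, g (x, s)) K := by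
  have hu : UniqueDiffOn ℝ K := uniqueDiffOn_convex hK hKi
  have hu' : UniqueDiffOn ℝ (K ×ˢ Icc (0 : ℝ) 1) := hu.prod (uniqueDiffOn_Icc zero_lt_one)
  induction m with
  | zero =>
    intro F _ _ _ g hg
    exact contDiffOn_zero.2 (continuousOn_intervalIntegral_of_prod hg.continuousOn)
  | succ m ih =>
    intro F _ _ _ g hg
    let g' : E × ℝ → E →L[ℝ] F := fun z =>
      (fderivWithin ℝ g (K ×ˢ Icc 0 1) z).comp (ContinuousLinearMap.inl ℝ E ℝ)
    have hg' : ContDiffOn ℝ m g' (K ×ˢ Icc 0 1) :=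
      (hg.fderivWithin hu' (by norm_cast)).clm_comp contDiffOn_const
    have hder : ∀ x ∈ K, ∀ s ∈ Icc (0 : ℝ) 1,
        HasFDerivWithinAt (fun y => g (y, s)) (g' (x, s)) K x := by
      intro x hx s hs
      have h1 := ((hg.differentiableOn (by simp)) (x, s) ⟨hx, hs⟩).hasFDerivWithinAt
      exact HasFDerivWithinAt.comp (t := K ×ˢ Icc (0 : ℝ) 1) x h1
        (hasFDerivAt_prodMk_left x s).hasFDerivWithinAt fun y hy => ⟨hy, hs⟩
    push_cast
    rw [contDiffOn_succ_iff_hasFDerivWithinAt_of_uniqueDiffOn hu]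
    refine ⟨by simp, fun x => ∫ s in (0 : ℝ)..1, g' (x, s), ih hg', fun x hx => ?_⟩
    exact hasFDerivWithinAt_intervalIntegral_of_convex hK hg.continuousOn hg'.continuousOn hder hx

/-- An integral over `[0, 1]` depends smoothly on its parameter, up to the boundary of a convex
parameter set. -/
lemma contDiffOn_intervalIntegral_of_convex {E F : Type u} [NormedAddCommGroup E]
    [NormedSpace ℝ E] [NormedAddCommGroup F] [NormedSpace ℝ F] [CompleteSpace F]
    {K : Set E} (hK : Convex ℝ K) (hKi : (interior K).Nonempty) {g : E × ℝ → F}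
    (hg : ContDiffOn ℝ ∞ g (K ×ˢ Icc 0 1)) :
    ContDiffOn ℝ ∞ (fun x => ∫ s in (0 : ℝ)..1, g (x, s)) K :=
  contDiffOn_infty.2 fun m =>
    contDiffOn_intervalIntegral_of_nat hK hKi m (hg.of_le (by exact_mod_cast le_top))

/-! ### Second-order calculus for the Laplacian -/

section
variable {E : Type*} [NormedAddCommGroup E] [InnerProductSpace ℝ E]

lemma fderiv_fderiv_mul_apply {f g : E → ℝ} {x : E} (hf : ContDiffAt ℝ 2 f x)
    (hg : ContDiffAt ℝ 2 g x) (a b : E) :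
    fderiv ℝ (fderiv ℝ fun y => f y * g y) x a b =
      f x * fderiv ℝ (fderiv ℝ g) x a b + fderiv ℝ f x a * fderiv ℝ g x b
        + (g x * fderiv ℝ (fderiv ℝ f) x a b + fderiv ℝ g x a * fderiv ℝ f x b) := by
  have hev : (fderiv ℝ fun y => f y * g y) =ᶠ[𝓝 x]
      fun y => f y • fderiv ℝ g y + g y • fderiv ℝ f y := by
    filter_upwards [hf.eventually (by simp), hg.eventually (by simp)] with y hfy hgy
    exact fderiv_fun_mul (hfy.differentiableAt (by simp)) (hgy.differentiableAt (by simp))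
  have df : DifferentiableAt ℝ f x := hf.differentiableAt (by simp)
  have dg : DifferentiableAt ℝ g x := hg.differentiableAt (by simp)
  have ddf : DifferentiableAt ℝ (fderiv ℝ f) x :=
    (hf.fderiv_right (m := 1) (by norm_num)).differentiableAt (by simp)
  have ddg : DifferentiableAt ℝ (fderiv ℝ g) x :=
    (hg.fderiv_right (m := 1) (by norm_num)).differentiableAt (by simp)
  rw [hev.fderiv_eq, fderiv_fun_add (df.fun_smul ddg) (dg.fun_smul ddf), fderiv_fun_smul df ddg,
    fderiv_fun_smul dg ddf]
  simp

/-- At a local minimum the second derivative is nonnegative in every direction. -/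
lemma IsLocalMin.fderiv_fderiv_nonneg {f : E → ℝ} {x : E} (hmin : IsLocalMin f x)
    (hf : ContDiffAt ℝ 2 f x) (a : E) : 0 ≤ fderiv ℝ (fderiv ℝ f) x a a := by
  have hline : Continuous fun s : ℝ => x + s • a := by fun_prop
  have hline0 : Tendsto (fun s : ℝ => x + s • a) (𝓝 0) (𝓝 x) := by
    simpa using hline.tendsto 0
  have hd : ∀ s : ℝ, HasDerivAt (fun s : ℝ => x + s • a) a s := fun s => by
    simpa using ((hasDerivAt_id s).smul_const a).const_add x
  have hderiv : deriv (fun s : ℝ => f (x + s • a)) =ᶠ[𝓝 0] fun s => fderiv ℝ f (x + s • a) a := by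
    filter_upwards [hline0.eventually (hf.eventually (by simp))] with s hs
    exact ((hs.differentiableAt (by simp)).hasFDerivAt.comp_hasDerivAt s (hd s)).deriv
  have hdd : deriv (deriv fun s : ℝ => f (x + s • a)) 0 = fderiv ℝ (fderiv ℝ f) x a a := by
    rw [hderiv.deriv_eq]
    have ddf : DifferentiableAt ℝ (fderiv ℝ f) (x + (0 : ℝ) • a) := by
      simpa using (hf.fderiv_right (m := 1) (by norm_num)).differentiableAt (by simp)
    have h1 := ddf.hasFDerivAt.comp_hasDerivAt (0 : ℝ) (hd 0)
    have h2 := h1.clm_apply (hasDerivAt_const (0 : ℝ) a)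
    simpa using h2.deriv
  have hmin' : IsLocalMin (fun s : ℝ => f (x + s • a)) 0 := by
    have := hline0.eventually hmin
    filter_upwards [this] with s hs
    simpa using hs
  by_contra hneg
  have hcont : ContinuousAt (fun s : ℝ => f (x + s • a)) 0 := by
    have : ContinuousAt f (x + (0 : ℝ) • a) := by simpa using hf.continuousAt
    exact ContinuousAt.comp (f := fun s : ℝ => x + s • a) this hline.continuousAt
  have hmax := isLocalMax_of_deriv_deriv_neg (by rw [hdd]; exact not_le.1 hneg) hmin'.deriv_eq_zero
    hcont
  -- a function with both a local minimum and a local maximum is locally constant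
  have hconst : (fun s : ℝ => f (x + s • a)) =ᶠ[𝓝 0] fun _ => f (x + (0 : ℝ) • a) := by
    filter_upwards [hmin', hmax] with s h1 h2 using le_antisymm h2 h1
  rw [hconst.deriv.deriv_eq] at hdd
  simp at hdd
  exact hneg hdd.le

variable [FiniteDimensional ℝ E]

lemma laplacian_eq_sum_fderiv_fderiv (f : E → ℝ) (x : E) :
    Δ f x = ∑ i, fderiv ℝ (fderiv ℝ f) x (stdOrthonormalBasis ℝ E i) (stdOrthonormalBasis ℝ E i) := by
  rw [InnerProductSpace.laplacian_eq_iteratedFDeriv_stdOrthonormalBasis]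
  simp [iteratedFDeriv_two_apply]

lemma laplacian_fun_mul [CompleteSpace E] {f g : E → ℝ} {x : E} (hf : ContDiffAt ℝ 2 f x)
    (hg : ContDiffAt ℝ 2 g x) :
    Δ (fun y => f y * g y) x =
      f x * Δ g x + g x * Δ f x + 2 * inner ℝ (gradient f x) (gradient g x) := by
  have hinner : inner ℝ (gradient f x) (gradient g x) =
      ∑ i, fderiv ℝ f x (stdOrthonormalBasis ℝ E i) * fderiv ℝ g x (stdOrthonormalBasis ℝ E i) := by
    rw [← (stdOrthonormalBasis ℝ E).sum_inner_mul_inner]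
    refine Finset.sum_congr rfl fun i _ => ?_
    rw [inner_gradient_left, real_inner_comm, inner_gradient_left]
  rw [hinner]
  simp only [laplacian_eq_sum_fderiv_fderiv, fderiv_fderiv_mul_apply hf hg, Finset.mul_sum,
    ← Finset.sum_add_distrib]
  refine Finset.sum_congr rfl fun i _ => ?_
  ring

lemma IsLocalMin.laplacian_nonneg {f : E → ℝ} {x : E} (hmin : IsLocalMin f x)
    (hf : ContDiffAt ℝ 2 f x) : 0 ≤ Δ f x := by
  rw [laplacian_eq_sum_fderiv_fderiv]
  exact Finset.sum_nonneg fun i _ => hmin.fderiv_fderiv_nonneg hf _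

lemma ContDiffAt.continuousAt_laplacian {f : E → ℝ} {x : E} (hf : ContDiffAt ℝ 2 f x) :
    ContinuousAt (Δ f) x := by
  have : Δ f = fun y => ∑ i, fderiv ℝ (fderiv ℝ f) y (stdOrthonormalBasis ℝ E i)
      (stdOrthonormalBasis ℝ E i) := funext (laplacian_eq_sum_fderiv_fderiv f)
  rw [this]
  have hc : ContinuousAt (fderiv ℝ (fderiv ℝ f)) x :=
    ((hf.fderiv_right (m := 1) (by norm_num)).fderiv_right (m := 0) (by norm_num)).continuousAt
  exact tendsto_finsetSum _ fun i _ => (hc.clm_apply continuousAt_const).clm_apply continuousAt_const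

/-- The Laplacian of a function that is smooth up to the boundary extends continuously there. -/
lemma ContDiffOn.exists_continuousOn_laplacian {f : E → ℝ} {S : Set E} (hS : UniqueDiffOn ℝ S)
    (hf : ContDiffOn ℝ 2 f S) :
    ∃ L : E → ℝ, ContinuousOn L S ∧ ∀ x ∈ interior S, Δ f x = L x := by
  refine ⟨fun y => ∑ i, fderivWithin ℝ (fderivWithin ℝ f S) S y (stdOrthonormalBasis ℝ E i)
      (stdOrthonormalBasis ℝ E i), ?_, ?_⟩
  · have hc : ContinuousOn (fderivWithin ℝ (fderivWithin ℝ f S) S) S :=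
      ((hf.fderivWithin hS (m := 1) (by norm_num)).fderivWithin hS (m := 0)
        (by norm_num)).continuousOn
    exact continuousOn_finsetSum _ fun i _ => (hc.clm_apply continuousOn_const).clm_apply
      continuousOn_const
  · intro x hx
    rw [laplacian_eq_sum_fderiv_fderiv]
    have hev : fderivWithin ℝ f S =ᶠ[𝓝 x] fderiv ℝ f := by
      filter_upwards [isOpen_interior.mem_nhds hx] with y hy
      exact fderivWithin_of_mem_nhds (mem_interior_iff_mem_nhds.1 hy)
    refine Finset.sum_congr rfl fun i _ => ?_
    rw [fderivWithin_of_mem_nhds (mem_interior_iff_mem_nhds.1 hx), hev.fderiv_eq]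
end

/-! ### Smooth boundaries and defining functions -/

section
variable {E : Type*} [NormedAddCommGroup E] [NormedSpace ℝ E]

lemma Convex.uniqueDiffOn_closure_of_isOpen {S : Set E} (hconv : Convex ℝ S) (hS : IsOpen S)
    (hne : S.Nonempty) : UniqueDiffOn ℝ (closure S) :=
  uniqueDiffOn_convex hconv.closure (hne.mono (interior_maximal subset_closure hS))

/-- A derivative within `S` computes the one-sided directional derivatives along the rays that
stay in `S`. -/
lemma HasFDerivWithinAt.tendsto_slope_right {f : E → ℝ} {f' : E →L[ℝ] ℝ} {S : Set E} {x h : E}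
    (hf : HasFDerivWithinAt f f' S x) (hS : ∀ᶠ s : ℝ in 𝓝[>] 0, x + s • h ∈ S) :
    Tendsto (fun s : ℝ => s⁻¹ * (f (x + s • h) - f x)) (𝓝[>] 0) (𝓝 (f' h)) := by
  have hlim : Tendsto (fun s : ℝ => s • h) (𝓝[>] 0) (𝓝 0) := by
    have : Continuous fun s : ℝ => s • h := by fun_prop
    simpa using (this.tendsto 0).mono_left nhdsWithin_le_nhds
  refine hf.lim (c := fun s : ℝ => s⁻¹) hlim hS (tendsto_const_nhds.congr' ?_)
  filter_upwards [self_mem_nhdsWithin] with s hs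
  rw [smul_smul, inv_mul_cancel₀ (ne_of_gt hs), one_smul]

lemma HasFDerivAt.eventually_lt_right {f : E → ℝ} {f' : E →L[ℝ] ℝ} {x h : E}
    (hf : HasFDerivAt f f' x) (hh : f' h < 0) : ∀ᶠ s : ℝ in 𝓝[>] 0, f (x + s • h) < f x := by
  have := hf.hasFDerivWithinAt (s := univ).tendsto_slope_right (h := h) (by simp)
  filter_upwards [this.eventually (gt_mem_nhds hh), self_mem_nhdsWithin] with s hs hs0
  have h1 : (0 : ℝ) < s⁻¹ := inv_pos.2 hs0
  nlinarith

/-- The derivative of a nonnegative function at a zero is nonnegative on inward directions. -/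
lemma HasFDerivWithinAt.nonneg_of_eventually_mem {f : E → ℝ} {f' : E →L[ℝ] ℝ} {S : Set E}
    {x h : E} (hf : HasFDerivWithinAt f f' S x) (hS : ∀ᶠ s : ℝ in 𝓝[>] 0, x + s • h ∈ S)
    (hx : f x = 0) (hnn : ∀ y ∈ S, 0 ≤ f y) : 0 ≤ f' h := by
  refine ge_of_tendsto (hf.tendsto_slope_right hS) ?_
  filter_upwards [hS, self_mem_nhdsWithin] with s hs hs0
  rw [hx, sub_zero]
  exact mul_nonneg (inv_nonneg.2 (le_of_lt hs0)) (hnn _ hs)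

/-- A continuous functional that is nonnegative on an open half space `{φ < 0}` is a multiple
of `φ`. -/
lemma exists_eq_smul_of_nonneg_of_neg {φ f' : E →L[ℝ] ℝ} (hφ : φ ≠ 0)
    (h : ∀ a, φ a < 0 → 0 ≤ f' a) : ∃ c : ℝ, f' = c • φ := by
  obtain ⟨e, he⟩ : ∃ e, φ e < 0 := by
    obtain ⟨a, ha⟩ := DFunLike.ne_iff.1 hφ
    rcases lt_or_gt_of_ne ha with h1 | h1
    · exact ⟨a, h1⟩
    · exact ⟨-a, by simpa using h1⟩
  have hnn : ∀ a, φ a = 0 → 0 ≤ f' a := by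
    intro a ha
    have hlim : Tendsto (fun s : ℝ => f' (a + s • e)) (𝓝[>] 0) (𝓝 (f' (a + (0 : ℝ) • e))) :=
      ((by fun_prop : Continuous fun s : ℝ => f' (a + s • e)).tendsto 0).mono_left
        nhdsWithin_le_nhds
    rw [zero_smul, add_zero] at hlim
    refine ge_of_tendsto hlim ?_
    filter_upwards [self_mem_nhdsWithin] with s hs
    exact h _ (by simpa [ha] using mul_neg_of_pos_of_neg hs he)
  have hker : ∀ a, φ a = 0 → f' a = 0 := fun a ha =>
    le_antisymm (by simpa using hnn (-a) (by simp [ha])) (hnn a ha)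
  refine ⟨f' e / φ e, ContinuousLinearMap.ext fun a => ?_⟩
  have h0 := hker (a - (φ a / φ e) • e) (by simp [div_mul_cancel₀ _ he.ne])
  simp only [map_sub, map_smul, smul_eq_mul, sub_eq_zero] at h0
  rw [h0, smul_apply, smul_eq_mul]
  ring
end

section
variable {n : ℕ} {Ω : Set (EuclideanSpace ℝ (Fin n))} {p : EuclideanSpace ℝ (Fin n)}
  {U : Set (EuclideanSpace ℝ (Fin n))} {ρ : EuclideanSpace ℝ (Fin n) → ℝ}

namespace IsLocalDefiningFunction

lemma contDiffAt (h : IsLocalDefiningFunction Ω p U ρ) {x} (hx : x ∈ U) : ContDiffAt ℝ ∞ ρ x :=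
  h.smooth.contDiffAt (h.isOpen.mem_nhds hx)

lemma hasFDerivAt (h : IsLocalDefiningFunction Ω p U ρ) {x} (hx : x ∈ U) :
    HasFDerivAt ρ (fderiv ℝ ρ x) x :=
  ((h.contDiffAt hx).differentiableAt (by simp)).hasFDerivAt

lemma mem_of_neg (h : IsLocalDefiningFunction Ω p U ρ) {x} (hx : x ∈ U) (hρ : ρ x < 0) : x ∈ Ω :=
  (h.inter_eq.symm.subset ⟨hx, hρ⟩ : x ∈ Ω ∩ U).1

lemma neg_of_mem (h : IsLocalDefiningFunction Ω p U ρ) {x} (hx : x ∈ U) (hΩ : x ∈ Ω) : ρ x < 0 :=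
  (h.inter_eq.subset ⟨hΩ, hx⟩ : x ∈ {x ∈ U | ρ x < 0}).2

lemma fderiv_gradient_pos (h : IsLocalDefiningFunction Ω p U ρ) :
    0 < fderiv ℝ ρ p (gradient ρ p) := by
  rw [← inner_gradient_left, real_inner_self_eq_norm_sq]
  exact pow_pos (norm_pos_iff.2 h.gradient_ne_zero) 2

lemma eq_zero (h : IsLocalDefiningFunction Ω p U ρ) (hΩ : IsOpen Ω) (hp : p ∈ frontier Ω) :
    ρ p = 0 := by
  have hpΩ : p ∉ Ω := by rw [hΩ.frontier_eq] at hp; exact hp.2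
  refine le_antisymm ?_ (not_lt.1 fun hneg => hpΩ (h.mem_of_neg h.mem hneg))
  by_contra hpos
  have hev : ∀ᶠ x in 𝓝 p, 0 < ρ x :=
    (h.contDiffAt h.mem).continuousAt.eventually (lt_mem_nhds (not_le.1 hpos))
  obtain ⟨x, hxΩ, hx, hxU⟩ := ((mem_closure_iff_frequently.1 hp.1).and_eventually
    (hev.and (h.isOpen.mem_nhds h.mem))).exists
  exact lt_asymm hx (h.neg_of_mem hxU hxΩ)

/-- From a zero of a defining function, the directions of decrease point into the domain. -/
lemma eventually_mem (h : IsLocalDefiningFunction Ω p U ρ) {x a : EuclideanSpace ℝ (Fin n)}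
    (hx : x ∈ U) (hρ : ρ x = 0) (ha : fderiv ℝ ρ x a < 0) :
    ∀ᶠ s : ℝ in 𝓝[>] 0, x + s • a ∈ Ω := by
  have hc : Tendsto (fun s : ℝ => x + s • a) (𝓝[>] 0) (𝓝 x) := by
    have : Continuous fun s : ℝ => x + s • a := by fun_prop
    simpa using (this.tendsto 0).mono_left nhdsWithin_le_nhds
  filter_upwards [(h.hasFDerivAt hx).eventually_lt_right ha, hc (h.isOpen.mem_nhds hx)]
    with s hs hsU
  exact h.mem_of_neg hsU (hρ ▸ hs)

lemma mem_frontier (h : IsLocalDefiningFunction Ω p U ρ) (hΩ : IsOpen Ω)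
    {x a : EuclideanSpace ℝ (Fin n)} (hx : x ∈ U) (hρ : ρ x = 0) (ha : 0 < fderiv ℝ ρ x a) :
    x ∈ frontier Ω := by
  rw [hΩ.frontier_eq]
  refine ⟨?_, fun hxΩ => (h.neg_of_mem hx hxΩ).ne hρ⟩
  have hc : Tendsto (fun s : ℝ => x + s • (-a)) (𝓝[>] 0) (𝓝 x) := by
    have : Continuous fun s : ℝ => x + s • (-a) := by fun_prop
    simpa using (this.tendsto 0).mono_left nhdsWithin_le_nhds
  exact mem_closure_of_tendsto hc (h.eventually_mem hx hρ (a := -a) (by simpa using ha))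

/-- Projection onto the boundary along a fixed transversal direction `a`: near `p`, the point
`x + τ x • a` lies on the boundary, and `τ` is smooth. -/
lemma exists_transversal_projection (h : IsLocalDefiningFunction Ω p U ρ) (hΩ : IsOpen Ω)
    (hp : p ∈ frontier Ω) {a : EuclideanSpace ℝ (Fin n)} (ha : 0 < fderiv ℝ ρ p a) :
    ∃ r > 0, ∃ τ : EuclideanSpace ℝ (Fin n) → ℝ, ContDiffOn ℝ ∞ τ (Metric.ball p r) ∧ τ p = 0 ∧
      ∀ x ∈ Metric.ball p r, x + τ x • a ∈ frontier Ω := by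
  let f : EuclideanSpace ℝ (Fin n) × ℝ → ℝ := fun z => ρ (z.1 + z.2 • a)
  have hf : ∀ z : EuclideanSpace ℝ (Fin n) × ℝ, z.1 + z.2 • a ∈ U → ContDiffAt ℝ ∞ f z :=
    fun z hz => (h.contDiffAt hz).comp z (f := fun z : EuclideanSpace ℝ (Fin n) × ℝ =>
      z.1 + z.2 • a) (by fun_prop)
  have hinv : ∀ z : EuclideanSpace ℝ (Fin n) × ℝ, z.1 + z.2 • a ∈ U →
      fderiv ℝ ρ (z.1 + z.2 • a) a ≠ 0 →
      (fderiv ℝ f z ∘L .inr ℝ (EuclideanSpace ℝ (Fin n)) ℝ).IsInvertible := by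
    intro z hz hza
    have hin : HasFDerivAt (fun z : EuclideanSpace ℝ (Fin n) × ℝ => z.1 + z.2 • a)
        (ContinuousLinearMap.fst ℝ (EuclideanSpace ℝ (Fin n)) ℝ +
          (ContinuousLinearMap.snd ℝ (EuclideanSpace ℝ (Fin n)) ℝ).smulRight a) z :=
      hasFDerivAt_fst.add (hasFDerivAt_snd.smul_const a)
    have hfd : fderiv ℝ f z = _ := ((h.hasFDerivAt hz).comp z hin).fderiv
    refine ⟨ContinuousLinearEquiv.unitsEquivAut ℝ (Units.mk0 _ hza), ?_⟩
    rw [hfd]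
    ext
    simp
  have hpU : (p, (0 : ℝ)).1 + (p, (0 : ℝ)).2 • a ∈ U := by simpa using h.mem
  have hpa : fderiv ℝ ρ ((p, (0 : ℝ)).1 + (p, (0 : ℝ)).2 • a) a ≠ 0 := by simpa using ha.ne'
  let τ := (hf (p, 0) hpU).implicitFunction (by simp) (hinv (p, 0) hpU hpa)
  have hτp : τ p = 0 :=
    (hf (p, 0) hpU).implicitFunction_apply_self (by simp) (hinv (p, 0) hpU hpa)
  have hτ : ContDiffAt ℝ ∞ τ p :=
    (hf (p, 0) hpU).contDiffAt_implicitFunction (by simp) (hinv (p, 0) hpU hpa)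
  have hfp : f (p, 0) = 0 := by simpa [f] using h.eq_zero hΩ hp
  have hτ0 : ∀ᶠ x in 𝓝 p, f (x, τ x) = 0 := by
    rw [← hfp]
    exact (hf (p, 0) hpU).eventually_apply_implicitFunction (by simp) (hinv (p, 0) hpU hpa)
  have hπ : Tendsto (fun x => x + τ x • a) (𝓝 p) (𝓝 p) := by
    have : ContinuousAt (fun x => x + τ x • a) p :=
      continuousAt_id.add (hτ.continuousAt.smul continuousAt_const)
    simpa [ContinuousAt, hτp] using this
  have hda : ∀ᶠ y in 𝓝 p, 0 < fderiv ℝ ρ y a :=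
    ((((h.contDiffAt h.mem).fderiv_right (m := 0) (by simp)).continuousAt.clm_apply
      continuousAt_const).eventually (lt_mem_nhds ha))
  have hC1 : ∀ᶠ x in 𝓝 p, ContDiffAt ℝ 1 τ x :=
    (hτ.of_le (by exact_mod_cast le_top)).eventually (by simp)
  obtain ⟨r, hr, hball⟩ := Metric.eventually_nhds_iff_ball.1
    (hC1.and (hτ0.eventually_nhds.and ((hπ.eventually hda).and
      (hπ.eventually (h.isOpen.mem_nhds h.mem)))))
  refine ⟨r, hr, τ, fun x hx => ?_, hτp, fun x hx => ?_⟩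
  · -- `ContDiffAt ℝ ∞` is not an open condition a priori: near `x`, the function `τ` is also the
    -- implicit function based at `(x, τ x)`.
    obtain ⟨h1, h2, h3, h4⟩ := hball x hx
    have huniq := (hf (x, τ x) h4).eventually_apply_eq_iff_implicitFunction (by simp)
      (hinv (x, τ x) h4 h3.ne')
    have hcont : Tendsto (fun y => (y, τ y)) (𝓝 x) (𝓝 (x, τ x)) :=
      (continuousAt_id.prodMk h1.continuousAt)
    refine ((hf (x, τ x) h4).contDiffAt_implicitFunction (by simp)
      (hinv (x, τ x) h4 h3.ne')).congr_of_eventuallyEq ?_ |>.contDiffWithinAt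
    filter_upwards [hcont.eventually huniq, h2] with y hy hy0
    exact (hy.1 (hy0.trans h2.self_of_nhds.symm)).symm
  · obtain ⟨-, h2, h3, h4⟩ := hball x hx
    exact h.mem_frontier hΩ h4 h2.self_of_nhds h3

end IsLocalDefiningFunction

/-- A function that is positive inside and vanishes at a boundary point has differential
proportional to the outer normal there. -/
lemma IsOuterUnitNormal.exists_eq_smul_innerSL {ν : EuclideanSpace ℝ (Fin n)} (hΩ : IsOpen Ω)
    (hp : p ∈ frontier Ω) (hν : IsOuterUnitNormal Ω p ν) {f : EuclideanSpace ℝ (Fin n) → ℝ}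
    {f' : EuclideanSpace ℝ (Fin n) →L[ℝ] ℝ} (hf : HasFDerivWithinAt f f' (closure Ω) p)
    (hfp : f p = 0) (hpos : ∀ x ∈ Ω, 0 ≤ f x) : ∃ c : ℝ, f' = c • innerSL ℝ ν := by
  obtain ⟨-, U, ρ, hρ, c, hc, hcν⟩ := hν
  have hfd : fderiv ℝ ρ p = c • innerSL ℝ ν := by
    ext a
    rw [← inner_gradient_left, hcν, inner_smul_left]
    simp
  have hne : fderiv ℝ ρ p ≠ 0 := fun h0 => by
    have := hρ.fderiv_gradient_pos
    simp [h0] at this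
  obtain ⟨d, hd⟩ := exists_eq_smul_of_nonneg_of_neg (f' := f') hne fun a ha =>
    (hf.mono subset_closure).nonneg_of_eventually_mem
      (hρ.eventually_mem hρ.mem (hρ.eq_zero hΩ hp) ha) hfp hpos
  exact ⟨d * c, by rw [hd, hfd, smul_smul]⟩
end

/-! ### Hopf's lemma for the heat equation with a potential -/

section
variable {n : ℕ} {Ω : Set (EuclideanSpace ℝ (Fin n))}
  {V : EuclideanSpace ℝ (Fin n) → ℝ} {u : EuclideanSpace ℝ (Fin n) → ℝ → ℝ}

lemma SmoothOn.slice {S : Set (EuclideanSpace ℝ (Fin n))} {J : Set ℝ} (hu : SmoothOn u (S ×ˢ J))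
    {t : ℝ} (ht : t ∈ J) : ContDiffOn ℝ ∞ (fun x => u x t) S :=
  ContDiffOn.comp (g := fun z : EuclideanSpace ℝ (Fin n) × ℝ => u z.1 z.2) hu
    (f := fun x => (x, t)) (by fun_prop) fun x hx => ⟨hx, ht⟩

lemma SmoothOn.timeSlice {S : Set (EuclideanSpace ℝ (Fin n))} {J : Set ℝ}
    (hu : SmoothOn u (S ×ˢ J)) {x : EuclideanSpace ℝ (Fin n)} (hx : x ∈ S) :
    ContDiffOn ℝ ∞ (fun t => u x t) J :=
  ContDiffOn.comp (g := fun z : EuclideanSpace ℝ (Fin n) × ℝ => u z.1 z.2) hu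
    (f := fun t => (x, t)) (by fun_prop) fun t ht => ⟨hx, ht⟩

lemma SmoothOn.contDiffAt_slice (hΩ : IsOpen Ω) {J : Set ℝ} (hu : SmoothOn u (closure Ω ×ˢ J))
    {x : EuclideanSpace ℝ (Fin n)} (hx : x ∈ Ω) {t : ℝ} (ht : t ∈ J) :
    ContDiffAt ℝ ∞ (fun y => u y t) x :=
  ((hu.slice ht).mono subset_closure).contDiffAt (hΩ.mem_nhds hx)

lemma SmoothOn.hasDerivWithinAt_timeDeriv {S : Set (EuclideanSpace ℝ (Fin n))}
    (hu : SmoothOn u (S ×ˢ Ici 0)) {x : EuclideanSpace ℝ (Fin n)} (hx : x ∈ S) {t : ℝ}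
    (ht : 0 ≤ t) : HasDerivWithinAt (fun s => u x s) (timeDeriv u x t) (Ici 0) t :=
  ((hu.timeSlice hx).differentiableOn (by simp) t ht).hasDerivWithinAt

lemma contDiffAt_barrier_profile {k : EuclideanSpace ℝ (Fin n) → ℝ}
    {x : EuclideanSpace ℝ (Fin n)} (hk : ContDiffAt ℝ 2 k x) (A b : ℝ) :
    ContDiffAt ℝ 2 (fun y => (k y - b) + A * ((k y - b) * (k y - b))) x := by
  fun_prop

lemma laplacian_barrier_profile {k : EuclideanSpace ℝ (Fin n) → ℝ}
    {x : EuclideanSpace ℝ (Fin n)} (hk : ContDiffAt ℝ 2 k x) (A b : ℝ) :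
    Δ (fun y => (k y - b) + A * ((k y - b) * (k y - b))) x =
      Δ k x + 2 * A * ((k x - b) * Δ k x + inner ℝ (gradient k x) (gradient k x)) := by
  have hq : ContDiffAt ℝ 2 (fun y => k y - b) x := by fun_prop
  have hΔ : Δ (fun y => k y - b) x = Δ k x := by
    have := hk.laplacian_sub (contDiffAt_const (c := b))
    simpa [Pi.sub_def] using this
  have hgrad : gradient (fun y => k y - b) x = gradient k x := by
    simp [gradient, fderiv_sub_const]
  have hqq : ContDiffAt ℝ 2 (fun y => (k y - b) * (k y - b)) x := hq.mul hq
  have hAq : ContDiffAt ℝ 2 (A • fun y => (k y - b) * (k y - b)) x := hqq.const_smul A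
  have h1 := hq.laplacian_add hAq
  have h2 := InnerProductSpace.laplacian_smul A (hq.mul hq)
  have h3 := laplacian_fun_mul hq hq
  have h4 : (fun y => (k y - b) + A * ((k y - b) * (k y - b))) =
    (fun y => k y - b) + A • (fun y => (k y - b) * (k y - b)) := by
    ext y; simp
  rw [h4, h1, h2, h3, hΔ, hgrad, smul_eq_mul]
  ring

/-- The quadratic barrier near a boundary point `p` and a time `t₀`: a function `k` of space,
vanishing at `p` with nonzero gradient, has `q + A q²` with `q = k - (t₀ - t)` as a strict
subsolution of `∂φ/∂t = Δφ - M φ` near `(p, t₀)`, once `A` is large. -/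
lemma exists_barrier {k : EuclideanSpace ℝ (Fin n) → ℝ} {p : EuclideanSpace ℝ (Fin n)}
    (hk : ContDiffAt ℝ ∞ k p) (hkp : k p = 0) (hgrad : gradient k p ≠ 0) (t₀ M : ℝ) :
    ∃ A ≥ 0, ∀ᶠ z : EuclideanSpace ℝ (Fin n) × ℝ in 𝓝 (p, t₀),
      0 < Δ k z.1 + 2 * A * ((k z.1 - (t₀ - z.2)) * Δ k z.1 +
          inner ℝ (gradient k z.1) (gradient k z.1))
        - (1 + 2 * A * (k z.1 - (t₀ - z.2)))
        - M * ((k z.1 - (t₀ - z.2)) + A * ((k z.1 - (t₀ - z.2)) * (k z.1 - (t₀ - z.2)))) := by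
  have hG : 0 < inner ℝ (gradient k p) (gradient k p) := real_inner_self_pos.2 hgrad
  set G := inner ℝ (gradient k p) (gradient k p) with hGdef
  refine ⟨(2 + |Δ k p|) / (2 * G), by positivity, ?_⟩
  have hfst : ContinuousAt (fun z : EuclideanSpace ℝ (Fin n) × ℝ => z.1) (p, t₀) :=
    continuousAt_fst
  have hk1 : ContinuousAt (fun z : EuclideanSpace ℝ (Fin n) × ℝ => k z.1) (p, t₀) :=
    ContinuousAt.comp (f := fun z : EuclideanSpace ℝ (Fin n) × ℝ => z.1) hk.continuousAt hfst
  have hk2 : ContinuousAt (fun z : EuclideanSpace ℝ (Fin n) × ℝ => Δ k z.1) (p, t₀) :=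
    ContinuousAt.comp (f := fun z : EuclideanSpace ℝ (Fin n) × ℝ => z.1) (g := Δ k)
      ((hk.of_le ENat.LEInfty.out).continuousAt_laplacian) hfst
  have hgr : ContinuousAt (gradient k) p :=
    (LinearIsometryEquiv.continuous _).continuousAt.comp
      (hk.fderiv_right (m := 0) (by simp)).continuousAt
  have hk3 : ContinuousAt (fun z : EuclideanSpace ℝ (Fin n) × ℝ => gradient k z.1) (p, t₀) :=
    ContinuousAt.comp (f := fun z : EuclideanSpace ℝ (Fin n) × ℝ => z.1) (g := gradient k) hgr hfst
  have hk4 := ContinuousAt.inner (𝕜 := ℝ) hk3 hk3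
  refine ContinuousAt.eventually_lt continuousAt_const (by fun_prop) ?_
  have : 2 * ((2 + |Δ k p|) / (2 * G)) * G = 2 + |Δ k p| := by field_simp
  simp only [hkp, sub_self, zero_mul, mul_zero, add_zero, sub_zero, zero_add, ← hGdef, this]
  linarith [neg_abs_le (Δ k p)]

/-- Hopf's boundary point lemma for the heat equation with a potential: at positive times the
differential of a positive solution does not vanish on the boundary. -/
lemma IsSchrodingerSolution.spaceDifferential_ne_zero (hΩ : IsOpen Ω)
    (hbdd : Bornology.IsBounded Ω) (hsmooth : HasSmoothBoundary Ω)
    (hV : ContinuousOn V (closure Ω)) (hu : IsSchrodingerSolution Ω V u)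
    (hpos : ∀ x ∈ Ω, ∀ t ≥ 0, 0 < u x t) {p : EuclideanSpace ℝ (Fin n)} (hp : p ∈ frontier Ω)
    {t₀ : ℝ} (ht₀ : 0 < t₀) : spaceDifferential Ω u p t₀ ≠ 0 := by
  obtain ⟨U, ρ, hρ⟩ := hsmooth p hp
  obtain ⟨M', hM'⟩ := hbdd.isCompact_closure.exists_bound_of_continuousOn hV
  set M : ℝ := |M'| with hM
  have hVM : ∀ x ∈ Ω, V x ≤ M := fun x hx =>
    (le_abs_self _).trans ((hM' x (subset_closure hx)).trans (le_abs_self M'))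
  have hM0 : 0 ≤ M := abs_nonneg M'
  have hρp : ρ p = 0 := hρ.eq_zero hΩ hp
  -- the penalization by `‖x - p‖²` and `t₀ - t` detaches `{q ≥ 0}` from the boundary except
  -- at `(p, t₀)`
  let k : EuclideanSpace ℝ (Fin n) → ℝ := fun x => -ρ x - ‖x - p‖ ^ 2
  have hkC : ∀ x ∈ U, ContDiffAt ℝ ∞ k x := fun x hx =>
    (hρ.contDiffAt hx).neg.sub ((contDiffAt_id.sub contDiffAt_const).norm_sq ℝ)
  have hkp : k p = 0 := by simp [k, hρp]
  have hkd : HasFDerivAt k (-fderiv ℝ ρ p) p := by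
    have : HasFDerivAt k _ p :=
      (hρ.hasFDerivAt hρ.mem).neg.sub ((hasFDerivAt_id p).sub_const p).norm_sq
    exact this.congr_fderiv (by simp)
  have hgrad : gradient k p ≠ 0 := by
    intro h0
    apply hρ.gradient_ne_zero
    have : gradient k p = -gradient ρ p := by simp [gradient, hkd.fderiv]
    simpa [this] using h0
  obtain ⟨A, hA, hΨ⟩ := exists_barrier (hkC p hρ.mem) hkp hgrad t₀ M
  let q : EuclideanSpace ℝ (Fin n) × ℝ → ℝ := fun z => k z.1 - (t₀ - z.2)
  let φ : EuclideanSpace ℝ (Fin n) × ℝ → ℝ := fun z => q z + A * (q z * q z)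
  have hUev : ∀ᶠ z : EuclideanSpace ℝ (Fin n) × ℝ in 𝓝 (p, t₀), z.1 ∈ U :=
    continuousAt_fst.eventually (hρ.isOpen.mem_nhds hρ.mem)
  obtain ⟨r', hr', hball⟩ := Metric.eventually_nhds_iff_ball.1 (hΨ.and hUev)
  set r := min (r' / 2) t₀ with hr
  have hr0 : 0 < r := lt_min (half_pos hr') ht₀
  have hrr' : r < r' := (min_le_left _ _).trans_lt (half_lt_self hr')
  have hrt : r ≤ t₀ := min_le_right _ _
  have hcl : ∀ z ∈ Metric.closedBall (p, t₀) r, z ∈ Metric.ball (p, t₀) r' :=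
    fun z hz => Metric.closedBall_subset_ball hrr' hz
  have hqcAt : ∀ z : EuclideanSpace ℝ (Fin n) × ℝ, z.1 ∈ U → ContinuousAt q z := by
    intro z hz
    have h1 : ContinuousAt (fun z : EuclideanSpace ℝ (Fin n) × ℝ => k z.1) z :=
      ContinuousAt.comp (f := fun z : EuclideanSpace ℝ (Fin n) × ℝ => z.1) (hkC _ hz).continuousAt
        continuousAt_fst
    exact h1.sub (by fun_prop)
  have hqc : ContinuousOn q (Metric.closedBall (p, t₀) r) := fun z hz =>
    (hqcAt z (hball z (hcl z hz)).2).continuousWithinAt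
  have hφc : ContinuousOn φ (Metric.closedBall (p, t₀) r) :=
    hqc.add (continuousOn_const.mul (hqc.mul hqc))
  let C : Set (EuclideanSpace ℝ (Fin n) × ℝ) :=
    (Metric.closedBall (p, t₀) r ∩ q ⁻¹' Ici 0) ∩ {z | z.2 ≤ t₀}
  have hCball : C ⊆ Metric.closedBall (p, t₀) r := fun z hz => hz.1.1
  have hCcl : IsClosed C :=
    (hqc.preimage_isClosed_of_isClosed Metric.isClosed_closedBall isClosed_Ici).inter
      (isClosed_le continuous_snd continuous_const)
  have hCcpt : IsCompact C := (isCompact_closedBall (p, t₀) r).of_isClosed_subset hCcl hCball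
  have hpC : (p, t₀) ∈ C := ⟨⟨Metric.mem_closedBall_self hr0.le, by simp [q, hkp]⟩, le_refl t₀⟩
  have ht0 : ∀ z ∈ Metric.closedBall (p, t₀) r, t₀ - r ≤ z.2 := by
    intro z hz
    have h1 : dist z.2 t₀ ≤ r := (le_max_right _ _).trans (Metric.mem_closedBall.1 hz)
    rw [Real.dist_eq] at h1
    linarith [(abs_le.1 h1).1]
  have hCΩ : ∀ z ∈ C, z ≠ (p, t₀) → z.1 ∈ Ω := by
    rintro ⟨x, t⟩ hz hne
    have hxU := (hball _ (hcl _ (hCball hz))).2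
    have h1 : 0 ≤ -ρ x - ‖x - p‖ ^ 2 - (t₀ - t) := hz.1.2
    have h2 : t ≤ t₀ := hz.2
    refine hρ.mem_of_neg hxU (lt_of_not_ge fun h3 => hne ?_)
    change 0 ≤ ρ x at h3
    have h4 : ‖x - p‖ ^ 2 = 0 := le_antisymm (by linarith) (sq_nonneg _)
    have h5 : x = p := by simpa [sub_eq_zero] using h4
    have h6 : t = t₀ := by rw [h4] at h1; linarith
    rw [h5, h6]
  have hup : u p t₀ = 0 := hu.dirichlet p hp t₀ ht₀.le
  have hCsub : C ⊆ closure Ω ×ˢ Ici 0 := by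
    intro z hz
    refine ⟨?_, mem_Ici.2 (by linarith [ht0 z (hCball hz)])⟩
    by_cases h : z = (p, t₀)
    · rw [h]; exact hp.1
    · exact subset_closure (hCΩ z hz h)
  have huc : ContinuousOn (fun z : EuclideanSpace ℝ (Fin n) × ℝ => u z.1 z.2) C :=
    (ContDiffOn.continuousOn hu.smooth).mono hCsub
  -- on the part of `∂C` on the sphere, the solution has a positive minimum
  let C' := C ∩ Metric.sphere (p, t₀) r
  have hC' : IsCompact C' := hCcpt.inter_right Metric.isClosed_sphere
  obtain ⟨m, hm, hmC⟩ := hC'.exists_forall_le' (huc.mono inter_subset_left) (a := 0) (by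
    intro z hz
    refine hpos _ (hCΩ z hz.1 fun h => ?_) _ (hCsub hz.1).2
    have := hz.2
    rw [h, mem_sphere_iff_norm, sub_self, norm_zero] at this
    exact hr0.ne this)
  obtain ⟨B, hB⟩ := hCcpt.exists_bound_of_continuousOn (hφc.mono hCball)
  set ε := m / (|B| + 1) with hε
  have hε0 : 0 < ε := by positivity
  have hεm : ∀ z ∈ C', ε * φ z < u z.1 z.2 := by
    intro z hz
    have h1 : φ z ≤ |B| := (le_abs_self _).trans ((hB z hz.1).trans (le_abs_self B))
    have h2 : ε * (|B| + 1) = m := by rw [hε]; field_simp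
    have := hmC z hz
    nlinarith
  let W : EuclideanSpace ℝ (Fin n) × ℝ → ℝ := fun z => u z.1 z.2 - ε * φ z
  have hWc : ContinuousOn W C := huc.sub (continuousOn_const.mul (hφc.mono hCball))
  -- comparison with the barrier on `C`
  have hW : ∀ z ∈ C, 0 ≤ W z := by
    obtain ⟨z₁, hz₁, hmin⟩ := hCcpt.exists_isMinOn ⟨_, hpC⟩ hWc
    suffices h0 : 0 ≤ W z₁ from fun z hz => h0.trans (hmin hz)
    by_contra hneg
    rw [not_le] at hneg
    obtain ⟨x₁, t₁⟩ := z₁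
    have hne : (x₁, t₁) ≠ (p, t₀) := by
      rintro h
      rw [h] at hneg
      simp [W, φ, q, hup, hkp] at hneg
    have hx₁ : x₁ ∈ Ω := hCΩ _ hz₁ hne
    obtain ⟨hΨ₁, hx₁U⟩ := hball _ (hcl _ (hCball hz₁))
    have ht₁' : (0 : ℝ) ≤ t₁ := (hCsub hz₁).2
    have hu₁ : 0 < u x₁ t₁ := hpos x₁ hx₁ t₁ ht₁'
    have hφ₁ : u x₁ t₁ < ε * φ (x₁, t₁) := by simpa [W] using hneg
    have hq₁ : 0 < q (x₁, t₁) := by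
      refine lt_of_le_of_ne hz₁.1.2 fun h => ?_
      have : φ (x₁, t₁) = 0 := by simp [φ, ← h]
      rw [this, mul_zero] at hφ₁
      exact lt_asymm hu₁ hφ₁
    have hdist : dist (x₁, t₁) (p, t₀) < r := by
      refine lt_of_le_of_ne (hCball hz₁) fun h => ?_
      exact lt_asymm hφ₁ (hεm _ ⟨hz₁, h⟩)
    have ht₁ : 0 < t₁ := by
      have h1 : dist t₁ t₀ < r := (le_max_right _ _).trans_lt hdist
      rw [Real.dist_eq] at h1
      linarith [(abs_lt.1 h1).1]
    have hnear : ∀ᶠ z in 𝓝 (x₁, t₁), z.2 ≤ t₀ → W (x₁, t₁) ≤ W z := by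
      filter_upwards [(hqcAt (x₁, t₁) hx₁U).eventually (lt_mem_nhds hq₁),
        Metric.isOpen_ball.mem_nhds hdist] with z hz1 hz2 hz3
      exact hmin ⟨⟨Metric.ball_subset_closedBall hz2, le_of_lt hz1⟩, hz3⟩
    have hk1 : ContDiffAt ℝ 2 k x₁ := (hkC x₁ hx₁U).of_le ENat.LEInfty.out
    have hus : ContDiffAt ℝ 2 (fun y => u y t₁) x₁ :=
      (hu.smooth.contDiffAt_slice hΩ hx₁ ht₁').of_le ENat.LEInfty.out
    have hφs := contDiffAt_barrier_profile hk1 A (t₀ - t₁)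
    -- second-order condition in space
    have hspace : 0 ≤ Δ (fun y => u y t₁) x₁ - ε * Δ (fun y => (k y - (t₀ - t₁)) +
        A * ((k y - (t₀ - t₁)) * (k y - (t₀ - t₁)))) x₁ := by
      have hlm : IsLocalMin (fun y => W (y, t₁)) x₁ := by
        have : Tendsto (fun y => (y, t₁)) (𝓝 x₁) (𝓝 (x₁, t₁)) :=
          (by fun_prop : Continuous fun y : EuclideanSpace ℝ (Fin n) => (y, t₁)).tendsto x₁
        filter_upwards [this.eventually hnear] with y hy using hy hz₁.2
      have h1 := hlm.laplacian_nonneg (hus.sub (contDiffAt_const.mul hφs))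
      have hεφs : ContDiffAt ℝ 2 (ε • fun y => (k y - (t₀ - t₁)) +
          A * ((k y - (t₀ - t₁)) * (k y - (t₀ - t₁)))) x₁ := hφs.const_smul ε
      have h2 := hus.laplacian_sub hεφs
      rw [InnerProductSpace.laplacian_smul ε hφs] at h2
      exact h1.trans_eq h2
    -- first-order condition in time, from the left
    have htime : timeDeriv u x₁ t₁ - ε * (1 + 2 * A * q (x₁, t₁)) ≤ 0 := by
      have hd : HasDerivAt (fun s => u x₁ s) (timeDeriv u x₁ t₁) t₁ :=
        (hu.smooth.hasDerivWithinAt_timeDeriv (subset_closure hx₁) ht₁').hasDerivAt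
          (Ici_mem_nhds ht₁)
      have hqd : HasDerivAt (fun s => q (x₁, s)) 1 t₁ := by
        have := ((hasDerivAt_id t₁).const_sub t₀).const_sub (k x₁)
        simpa [q] using this
      have hWd : HasDerivAt (fun s => W (x₁, s))
          (timeDeriv u x₁ t₁ - ε * (1 + 2 * A * q (x₁, t₁))) t₁ := by
        have := hd.sub ((hqd.add ((hqd.mul hqd).const_mul A)).const_mul ε)
        refine this.congr_deriv ?_
        ring
      by_contra hgt
      rw [not_le] at hgt
      have hlt := hWd.hasFDerivAt.eventually_lt_right (h := -1) (by simpa using hgt)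
      have hc : Tendsto (fun s : ℝ => (x₁, t₁ + s • (-1 : ℝ))) (𝓝[>] 0) (𝓝 (x₁, t₁)) := by
        have : Continuous fun s : ℝ => (x₁, t₁ + s • (-1 : ℝ)) := by fun_prop
        simpa using (this.tendsto 0).mono_left nhdsWithin_le_nhds
      obtain ⟨s, ⟨h1, h2⟩, hs⟩ := ((hlt.and (hc.eventually hnear)).and self_mem_nhdsWithin).exists
      have hs0 : (0 : ℝ) < s := hs
      have ht₁0 : t₁ ≤ t₀ := hz₁.2
      exact absurd h1 (not_lt.2 (h2 (by
        change t₁ + s • (-1 : ℝ) ≤ t₀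
        rw [smul_eq_mul]; linarith)))
    rw [laplacian_barrier_profile hk1] at hspace
    have heq := hu.equation x₁ hx₁ t₁ ht₁'
    rw [spaceLaplacian] at heq
    have hVu : V x₁ * u x₁ t₁ ≤ M * (ε * φ (x₁, t₁)) :=
      (mul_le_mul_of_nonneg_right (hVM x₁ hx₁) hu₁.le).trans
        (mul_le_mul_of_nonneg_left hφ₁.le hM0)
    have hΨε := mul_pos hε0 hΨ₁
    simp only [φ, q] at hVu htime
    nlinarith
  -- compare the slopes at `(p, t₀)` in the inward direction
  set a := -gradient ρ p with ha
  have hρa : fderiv ℝ ρ p a < 0 := by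
    rw [ha, map_neg]; exact neg_neg_of_pos hρ.fderiv_gradient_pos
  have hin := hρ.eventually_mem hρ.mem hρp hρa
  have huf : HasFDerivWithinAt (fun y => u y t₀) (spaceDifferential Ω u p t₀) (closure Ω) p :=
    ((hu.smooth.slice ht₀.le).differentiableOn (by simp) p hp.1).hasFDerivWithinAt
  have hlim1 := huf.tendsto_slope_right (hin.mono fun s hs => subset_closure hs)
  have hlim2 := ((hkd.hasFDerivWithinAt (s := univ)).tendsto_slope_right (h := a)
    (by simp)).const_mul ε
  have hknear := hkd.neg.eventually_lt_right (h := a) (by simpa using hρa)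
  have hc : Tendsto (fun s : ℝ => (p + s • a, t₀)) (𝓝[>] 0) (𝓝 (p, t₀)) := by
    have : Continuous fun s : ℝ => (p + s • a, t₀) := by fun_prop
    simpa using (this.tendsto 0).mono_left nhdsWithin_le_nhds
  have hle : ε * (-fderiv ℝ ρ p) a ≤ spaceDifferential Ω u p t₀ a := by
    refine le_of_tendsto_of_tendsto hlim2 hlim1 ?_
    filter_upwards [hknear, hc (Metric.closedBall_mem_nhds (p, t₀) hr0), self_mem_nhdsWithin]
      with s hs1 hs2 hs3
    have hkpos : 0 < k (p + s • a) := by simpa [hkp] using hs1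
    have hq : q (p + s • a, t₀) = k (p + s • a) := by simp [q]
    have hmem : (p + s • a, t₀) ∈ C := ⟨⟨hs2, by rw [mem_preimage, hq]; exact hkpos.le⟩, le_refl t₀⟩
    have hWs := hW _ hmem
    have hφs : k (p + s • a) ≤ φ (p + s • a, t₀) := by
      simp only [φ, hq]
      nlinarith [mul_nonneg hA (mul_self_nonneg (k (p + s • a)))]
    have hWs' : ε * φ (p + s • a, t₀) ≤ u (p + s • a) t₀ := by simpa [W] using hWs
    have hs4 : (0 : ℝ) < s⁻¹ := inv_pos.2 hs3
    rw [hkp, hup, sub_zero, sub_zero, mul_left_comm]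
    exact mul_le_mul_of_nonneg_left
      ((mul_le_mul_of_nonneg_left hφs hε0.le).trans hWs') hs4.le
  intro h0
  rw [h0] at hle
  have : 0 < ε * (-fderiv ℝ ρ p) a := mul_pos hε0 (by simpa using hρa)
  simp only [zero_apply] at hle
  linarith
end

/-! ### The quotient of two solutions -/

section
variable {n : ℕ} {Ω : Set (EuclideanSpace ℝ (Fin n))}
  {V : EuclideanSpace ℝ (Fin n) → ℝ} {u u₀ u₁ v : EuclideanSpace ℝ (Fin n) → ℝ → ℝ}

lemma smoothOn_of_eq_div (hu₀ : SmoothOn u₀ (closure Ω ×ˢ Ici 0))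
    (hu₁ : SmoothOn u₁ (closure Ω ×ˢ Ici 0)) (hpos : ∀ x ∈ Ω, ∀ t ≥ 0, 0 < u₀ x t)
    (hv : ∀ x ∈ Ω, ∀ t ≥ 0, v x t = u₁ x t / u₀ x t) : SmoothOn v (Ω ×ˢ Ici 0) := by
  have hsub : Ω ×ˢ Ici (0 : ℝ) ⊆ closure Ω ×ˢ Ici 0 := prod_mono subset_closure Subset.rfl
  refine ContDiffOn.congr (ContDiffOn.div (ContDiffOn.mono hu₁ hsub) (ContDiffOn.mono hu₀ hsub)
    fun z hz => (hpos z.1 hz.1 z.2 hz.2).ne') fun z hz => hv z.1 hz.1 z.2 hz.2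

/-- The equation for the quotient with the denominator cleared; in this form it survives the
passage to the boundary, where `u₀` vanishes. -/
lemma quotient_identity (hΩ : IsOpen Ω) (hu₀ : IsSchrodingerSolution Ω V u₀)
    (hu₁ : IsSchrodingerSolution Ω V u₁) (hpos : ∀ x ∈ Ω, ∀ t ≥ 0, 0 < u₀ x t)
    (hv : ∀ x ∈ Ω, ∀ t ≥ 0, v x t = u₁ x t / u₀ x t) {x : EuclideanSpace ℝ (Fin n)}
    (hx : x ∈ Ω) {t : ℝ} (ht : 0 ≤ t) :
    u₀ x t * (timeDeriv v x t - spaceLaplacian v x t) =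
      2 * inner ℝ (spaceGradient u₀ x t) (spaceGradient v x t) := by
  have hvs : SmoothOn v (Ω ×ˢ Ici 0) := smoothOn_of_eq_div hu₀.smooth hu₁.smooth hpos hv
  have hmul : ∀ y ∈ Ω, ∀ s ≥ 0, u₁ y s = v y s * u₀ y s := fun y hy s hs => by
    rw [hv y hy s hs, div_mul_cancel₀ _ (hpos y hy s hs).ne']
  have hvx : ContDiffAt ℝ 2 (fun y => v y t) x :=
    ((hvs.slice ht).contDiffAt (hΩ.mem_nhds hx)).of_le ENat.LEInfty.out
  have hux : ContDiffAt ℝ 2 (fun y => u₀ y t) x :=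
    (hu₀.smooth.contDiffAt_slice hΩ hx ht).of_le ENat.LEInfty.out
  have hlap : spaceLaplacian u₁ x t = v x t * spaceLaplacian u₀ x t +
      u₀ x t * spaceLaplacian v x t +
      2 * inner ℝ (spaceGradient v x t) (spaceGradient u₀ x t) := by
    have hev : (fun y => u₁ y t) =ᶠ[𝓝 x] fun y => v y t * u₀ y t := by
      filter_upwards [hΩ.mem_nhds hx] with y hy using hmul y hy t ht
    exact (InnerProductSpace.laplacian_congr_nhds hev).eq_of_nhds.trans (laplacian_fun_mul hvx hux)
  have htime : timeDeriv u₁ x t = timeDeriv v x t * u₀ x t + v x t * timeDeriv u₀ x t := by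
    have h1 := (hvs.hasDerivWithinAt_timeDeriv hx ht).mul
      (hu₀.smooth.hasDerivWithinAt_timeDeriv (subset_closure hx) ht)
    exact (h1.congr (fun s hs => hmul x hx s hs) (hmul x hx t ht)).derivWithin
      (uniqueDiffOn_Ici (0 : ℝ) t ht)
  have e₀ := hu₀.equation x hx t ht
  have e₁ := hu₁.equation x hx t ht
  rw [hlap, htime, e₀, hmul x hx t ht, real_inner_comm] at e₁
  linarith

lemma spaceGradient_log (hΩ : IsOpen Ω) (hu₀ : SmoothOn u₀ (closure Ω ×ˢ Ici 0))
    (hpos : ∀ x ∈ Ω, ∀ t ≥ 0, 0 < u₀ x t) {x : EuclideanSpace ℝ (Fin n)}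
    (hx : x ∈ Ω) {t : ℝ} (ht : 0 ≤ t) :
    spaceGradient (fun y s => Real.log (u₀ y s)) x t = (u₀ x t)⁻¹ • spaceGradient u₀ x t := by
  have h := ((hu₀.contDiffAt_slice hΩ hx ht).differentiableAt (by simp)).hasFDerivAt.log
    (hpos x hx t ht).ne'
  simp only [spaceGradient, gradient, h.fderiv, map_smul]

lemma quotient_equation (hΩ : IsOpen Ω) (hu₀ : IsSchrodingerSolution Ω V u₀)
    (hu₁ : IsSchrodingerSolution Ω V u₁) (hpos : ∀ x ∈ Ω, ∀ t ≥ 0, 0 < u₀ x t)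
    (hv : ∀ x ∈ Ω, ∀ t ≥ 0, v x t = u₁ x t / u₀ x t) {x : EuclideanSpace ℝ (Fin n)}
    (hx : x ∈ Ω) {t : ℝ} (ht : 0 ≤ t) :
    timeDeriv v x t - spaceLaplacian v x t
      - 2 * inner ℝ (spaceGradient (fun y s => Real.log (u₀ y s)) x t) (spaceGradient v x t)
        = 0 := by
  have h := quotient_identity hΩ hu₀ hu₁ hpos hv hx ht
  have hne := (hpos x hx t ht).ne'
  rw [spaceGradient_log hΩ hu₀.smooth hpos hx ht, real_inner_smul_left]
  field_simp
  linarith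

/-- Hadamard factorization at the boundary: `u` vanishes on `∂Ω`, so near a boundary point it is
divisible, within functions smooth up to the boundary, by the displacement `τ` that carries points
to `∂Ω` in the direction `a`. By convexity the segment of integration stays in the closed domain. -/
lemma SmoothOn.exists_factor (hΩ : IsOpen Ω) (hconv : Convex ℝ Ω)
    (hu : SmoothOn u (closure Ω ×ˢ Ici 0)) (hdir : ∀ x ∈ frontier Ω, ∀ t ≥ 0, u x t = 0)
    {p a : EuclideanSpace ℝ (Fin n)} (hp : p ∈ frontier Ω) {r : ℝ} (hr : 0 < r)
    {τ : EuclideanSpace ℝ (Fin n) → ℝ} (hτ : ContDiffOn ℝ ∞ τ (Metric.ball p r))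
    (hπ : ∀ x ∈ Metric.ball p r, x + τ x • a ∈ frontier Ω) :
    ∃ w : EuclideanSpace ℝ (Fin n) → ℝ → ℝ,
      SmoothOn w ((closure Ω ∩ Metric.ball p r) ×ˢ Ici 0) ∧
      ∀ x ∈ closure Ω ∩ Metric.ball p r, ∀ t ≥ 0, u x t = -τ x * w x t := by
  set S := closure Ω ∩ Metric.ball p r
  set D := closure Ω ×ˢ Ici (0 : ℝ)
  have hne : (Ω ∩ Metric.ball p r).Nonempty := by
    obtain ⟨y, hy⟩ := mem_closure_iff.1 hp.1 _ Metric.isOpen_ball (Metric.mem_ball_self hr)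
    exact ⟨y, hy.2, hy.1⟩
  have hD : UniqueDiffOn ℝ D :=
    (hconv.uniqueDiffOn_closure_of_isOpen hΩ (hne.mono inter_subset_left)).prod
      (uniqueDiffOn_Ici 0)
  have hK : Convex ℝ (S ×ˢ Ici (0 : ℝ)) :=
    (hconv.closure.inter (convex_ball p r)).prod (convex_Ici 0)
  have hKi : (interior (S ×ˢ Ici (0 : ℝ))).Nonempty := by
    rw [interior_prod_eq, interior_Ici]
    refine (hne.mono ?_).prod nonempty_Ioi
    exact interior_maximal (inter_subset_inter_left _ subset_closure)
      (hΩ.inter Metric.isOpen_ball)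
  have hmaps : ∀ x ∈ S, ∀ s ∈ Icc (0 : ℝ) 1, x + (s * τ x) • a ∈ closure Ω := by
    intro x hx s hs
    have := hconv.closure hx.1 (hπ x hx.2).1 (sub_nonneg.2 hs.2) hs.1 (sub_add_cancel 1 s)
    convert this using 1
    module
  let f : EuclideanSpace ℝ (Fin n) × ℝ → ℝ := fun z => u z.1 z.2
  have hf : ContDiffOn ℝ ∞ f D := hu
  let γ : (EuclideanSpace ℝ (Fin n) × ℝ) × ℝ → EuclideanSpace ℝ (Fin n) × ℝ :=
    fun y => (y.1.1 + (y.2 * τ y.1.1) • a, y.1.2)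
  have hγ : ContDiffOn ℝ ∞ γ ((S ×ˢ Ici 0) ×ˢ Icc 0 1) := by
    have h1 : ContDiffOn ℝ ∞ (fun y : (EuclideanSpace ℝ (Fin n) × ℝ) × ℝ => τ y.1.1)
        ((S ×ˢ Ici 0) ×ˢ Icc 0 1) :=
      hτ.comp (f := fun y : (EuclideanSpace ℝ (Fin n) × ℝ) × ℝ => y.1.1) (by fun_prop)
        fun y hy => hy.1.1.2
    have h2 : ContDiffOn ℝ ∞ (fun y : (EuclideanSpace ℝ (Fin n) × ℝ) × ℝ =>
        y.1.1 + (y.2 * τ y.1.1) • a) ((S ×ˢ Ici 0) ×ˢ Icc 0 1) :=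
      contDiffOn_fst.fst.add ((contDiffOn_snd.mul h1).smul contDiffOn_const)
    exact h2.prodMk contDiffOn_fst.snd
  have hγm : MapsTo γ ((S ×ˢ Ici 0) ×ˢ Icc 0 1) D := fun y hy =>
    ⟨hmaps _ hy.1.1 _ hy.2, hy.1.2⟩
  let g : (EuclideanSpace ℝ (Fin n) × ℝ) × ℝ → ℝ := fun y => fderivWithin ℝ f D (γ y) (a, 0)
  have hg : ContDiffOn ℝ ∞ g ((S ×ˢ Ici 0) ×ˢ Icc 0 1) :=
    ((hf.fderivWithin hD (m := ∞) (by simp)).comp hγ hγm).clm_apply contDiffOn_const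
  refine ⟨fun x t => ∫ s in (0 : ℝ)..1, g ((x, t), s),
    contDiffOn_intervalIntegral_of_convex hK hKi hg, fun x hx t ht => ?_⟩
  have hsec : ContinuousOn (fun s : ℝ => ((x, t), s)) (Icc 0 1) := by fun_prop
  have hsecm : MapsTo (fun s : ℝ => ((x, t), s)) (Icc 0 1) ((S ×ˢ Ici 0) ×ˢ Icc 0 1) :=
    fun s hs => ⟨⟨hx, ht⟩, hs⟩
  have hder : ∀ s ∈ Ioo (0 : ℝ) 1,
      HasDerivAt (fun s => f (γ ((x, t), s))) (τ x * g ((x, t), s)) s := by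
    intro s hs
    have hs' : s ∈ Icc (0 : ℝ) 1 := Ioo_subset_Icc_self hs
    have h1 := (hf.differentiableOn (by simp) _ (hγm (hsecm hs'))).hasFDerivWithinAt
    have h2 : HasDerivWithinAt (fun s : ℝ => γ ((x, t), s)) (τ x • a, 0) (Icc 0 1) s := by
      have h3 : HasDerivAt (fun s : ℝ => x + (s * τ x) • a) (τ x • a) s := by
        simpa using (((hasDerivAt_id s).mul_const (τ x)).smul_const a).const_add x
      exact (h3.prodMk (hasDerivAt_const s t)).hasDerivWithinAt
    have h4 := (h1.comp_hasDerivWithinAt (t := D) s h2 fun σ hσ => hγm (hsecm hσ)).hasDerivAt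
      (Icc_mem_nhds hs.1 hs.2)
    have h5 : ((τ x • a, 0) : EuclideanSpace ℝ (Fin n) × ℝ) = τ x • (a, 0) := by simp
    rw [h5, map_smul, smul_eq_mul] at h4
    exact h4
  have hFTC := intervalIntegral.integral_eq_sub_of_hasDerivAt_of_le zero_le_one
    (hf.continuousOn.comp (hγ.continuousOn.comp hsec hsecm) fun s hs => hγm (hsecm hs)) hder
    (ContinuousOn.intervalIntegrable_of_Icc zero_le_one
      (continuousOn_const.mul (hg.continuousOn.comp hsec hsecm)))
  have hend : u (x + τ x • a) t = 0 := hdir _ (hπ x hx.2) t ht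
  rw [intervalIntegral.integral_const_mul] at hFTC
  simp only [f, γ, one_mul, zero_mul, zero_smul, add_zero, hend, zero_sub, Function.comp] at hFTC
  linarith

open Classical in
/-- The quotient `u₁ / u₀` on `Ω`, and its limit from inside `Ω` elsewhere (a junk value where the
limit does not exist). -/
noncomputable def quotientExtension (Ω : Set (EuclideanSpace ℝ (Fin n)))
    (u₁ u₀ : EuclideanSpace ℝ (Fin n) → ℝ → ℝ) (x : EuclideanSpace ℝ (Fin n)) (t : ℝ) : ℝ :=
  if x ∈ Ω then u₁ x t / u₀ x t else limUnder (𝓝[Ω] x) fun y => u₁ y t / u₀ y t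

lemma quotientExtension_of_mem {x : EuclideanSpace ℝ (Fin n)} (hx : x ∈ Ω) (t : ℝ) :
    quotientExtension Ω u₁ u₀ x t = u₁ x t / u₀ x t := if_pos hx

/-- The quotient is smooth up to the boundary wherever the differential of `u₀` does not vanish:
the factor `τ` cancels. -/
lemma contDiffWithinAt_quotientExtension (hΩ : IsOpen Ω) (hconv : Convex ℝ Ω)
    (hsmooth : HasSmoothBoundary Ω) (hu₀ : IsSchrodingerSolution Ω V u₀)
    (hu₁ : IsSchrodingerSolution Ω V u₁) (hpos : ∀ x ∈ Ω, ∀ t ≥ 0, 0 < u₀ x t)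
    {p : EuclideanSpace ℝ (Fin n)} (hp : p ∈ frontier Ω) {t : ℝ} (ht : 0 ≤ t)
    (hne : spaceDifferential Ω u₀ p t ≠ 0) :
    ContDiffWithinAt ℝ ∞
      (fun z : EuclideanSpace ℝ (Fin n) × ℝ => quotientExtension Ω u₁ u₀ z.1 z.2)
      (closure Ω ×ˢ Ici 0) (p, t) := by
  obtain ⟨U, ρ, hρ⟩ := hsmooth p hp
  obtain ⟨r, hr, τ, hτ, hτp, hπ⟩ := hρ.exists_transversal_projection hΩ hp hρ.fderiv_gradient_pos
  obtain ⟨w₀, hw₀, huw₀⟩ := hu₀.smooth.exists_factor hΩ hconv hu₀.dirichlet hp hr hτ hπ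
  obtain ⟨w₁, hw₁, huw₁⟩ := hu₁.smooth.exists_factor hΩ hconv hu₁.dirichlet hp hr hτ hπ
  set S := closure Ω ∩ Metric.ball p r
  have hpS : p ∈ S := ⟨hp.1, Metric.mem_ball_self hr⟩
  have hSn : S ∈ 𝓝[closure Ω] p := inter_mem_nhdsWithin _ (Metric.ball_mem_nhds p hr)
  have hΩne : Ω.Nonempty := closure_nonempty_iff.1 ⟨p, hp.1⟩
  have hw₀p : w₀ p t ≠ 0 := by
    intro h0
    apply hne
    have hwd : HasFDerivWithinAt (fun x => w₀ x t) (fderivWithin ℝ (fun x => w₀ x t) S p) S p :=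
      ((hw₀.slice ht).differentiableOn (by simp) p hpS).hasFDerivWithinAt
    have hτd : HasFDerivWithinAt τ (fderivWithin ℝ τ (Metric.ball p r) p) S p :=
      (hτ.differentiableOn (by simp) p hpS.2).hasFDerivWithinAt.mono inter_subset_right
    have h1 := (hτd.neg.mul hwd).congr (fun x hx => huw₀ x hx t ht) (huw₀ p hpS t ht)
    have h2 := (h1.mono_of_mem_nhdsWithin hSn).fderivWithin
      (hconv.uniqueDiffOn_closure_of_isOpen hΩ hΩne p hp.1)
    rw [spaceDifferential, h2]
    simp [hτp, h0]
  have hquot : ∀ x ∈ Ω ∩ Metric.ball p r, ∀ s ≥ 0, u₁ x s / u₀ x s = w₁ x s / w₀ x s := by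
    intro x hx s hs
    have hxS : x ∈ S := ⟨subset_closure hx.1, hx.2⟩
    have h0 := hpos x hx.1 s hs
    rw [huw₀ x hxS s hs] at h0
    rw [huw₀ x hxS s hs, huw₁ x hxS s hs, mul_div_mul_left _ _ (left_ne_zero_of_mul h0.ne')]
  have hKn : S ×ˢ Ici (0 : ℝ) ∈ 𝓝[closure Ω ×ˢ Ici 0] (p, t) := by
    rw [nhdsWithin_prod_eq]
    exact prod_mem_prod hSn self_mem_nhdsWithin
  have hdiv : ContDiffWithinAt ℝ ∞
      (fun z : EuclideanSpace ℝ (Fin n) × ℝ => w₁ z.1 z.2 / w₀ z.1 z.2)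
      (closure Ω ×ˢ Ici 0) (p, t) :=
    (ContDiffWithinAt.div (hw₁ (p, t) ⟨hpS, ht⟩) (hw₀ (p, t) ⟨hpS, ht⟩) hw₀p).mono_of_mem_nhdsWithin
      hKn
  have hw₀ev : ∀ᶠ z : EuclideanSpace ℝ (Fin n) × ℝ in 𝓝[closure Ω ×ˢ Ici 0] (p, t),
      w₀ z.1 z.2 ≠ 0 :=
    ((hw₀ (p, t) ⟨hpS, ht⟩).continuousWithinAt.mono_of_mem_nhdsWithin hKn).eventually_ne hw₀p
  have hev : ∀ z ∈ S ×ˢ Ici (0 : ℝ), w₀ z.1 z.2 ≠ 0 →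
      quotientExtension Ω u₁ u₀ z.1 z.2 = w₁ z.1 z.2 / w₀ z.1 z.2 := by
    rintro ⟨x, s⟩ ⟨hx, hs⟩ hz
    by_cases hxΩ : x ∈ Ω
    · rw [quotientExtension_of_mem hxΩ, hquot x ⟨hxΩ, hx.2⟩ s hs]
    · have : (𝓝[Ω] x).NeBot := mem_closure_iff_nhdsWithin_neBot.1 hx.1
      have hball : Metric.ball p r ∈ 𝓝[Ω] x :=
        mem_nhdsWithin_of_mem_nhds (Metric.isOpen_ball.mem_nhds hx.2)
      have hSx : S ∈ 𝓝[Ω] x := by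
        filter_upwards [self_mem_nhdsWithin, hball] with y hy hy' using ⟨subset_closure hy, hy'⟩
      have hc₀ : Tendsto (fun y => w₀ y s) (𝓝[Ω] x) (𝓝 (w₀ x s)) :=
        ((hw₀.slice hs).continuousOn x hx).mono_of_mem_nhdsWithin hSx
      have hc₁ : Tendsto (fun y => w₁ y s) (𝓝[Ω] x) (𝓝 (w₁ x s)) :=
        ((hw₁.slice hs).continuousOn x hx).mono_of_mem_nhdsWithin hSx
      rw [quotientExtension, if_neg hxΩ]
      refine Tendsto.limUnder_eq ((hc₁.div hc₀ hz).congr' ?_)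
      filter_upwards [self_mem_nhdsWithin, hball] with y hy hy' using (hquot y ⟨hy, hy'⟩ s hs).symm
  refine hdiv.congr_of_eventuallyEq ?_ (hev (p, t) ⟨hpS, ht⟩ hw₀p)
  filter_upwards [hKn, hw₀ev] with z hz hz' using hev z hz hz'

/-- At a boundary point the identity `u₀ (∂v/∂t - Δv) = 2 ⟨∇u₀, ∇v⟩` degenerates to
`⟨∇u₀, ∇v⟩ = 0`, and `∇u₀` is a nonzero multiple of the normal. -/
lemma spaceDifferential_normal_eq_zero (hΩ : IsOpen Ω) (hconv : Convex ℝ Ω)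
    (hu₀ : IsSchrodingerSolution Ω V u₀)
    (hu₁ : IsSchrodingerSolution Ω V u₁) (hpos : ∀ x ∈ Ω, ∀ t ≥ 0, 0 < u₀ x t)
    (hv : ∀ x ∈ Ω, ∀ t ≥ 0, v x t = u₁ x t / u₀ x t) {J : Set ℝ} (hJ : J ⊆ Ici 0)
    (hJu : UniqueDiffOn ℝ J) (hvs : SmoothOn v (closure Ω ×ˢ J))
    {p ν : EuclideanSpace ℝ (Fin n)} (hp : p ∈ frontier Ω) {t : ℝ} (ht : t ∈ J)
    (hJt : J ∈ 𝓝[Ici 0] t) (hne : spaceDifferential Ω u₀ p t ≠ 0)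
    (hν : IsOuterUnitNormal Ω p ν) : spaceDifferential Ω v p t ν = 0 := by
  have ht0 : 0 ≤ t := hJ ht
  have hclu : UniqueDiffOn ℝ (closure Ω) :=
    hconv.uniqueDiffOn_closure_of_isOpen hΩ (closure_nonempty_iff.1 ⟨p, hp.1⟩)
  have hDu : UniqueDiffOn ℝ (closure Ω ×ˢ J) := hclu.prod hJu
  have hvf : ContDiffOn ℝ ∞ (fun z : EuclideanSpace ℝ (Fin n) × ℝ => v z.1 z.2)
    (closure Ω ×ˢ J) := hvs
  set T : EuclideanSpace ℝ (Fin n) → ℝ := fun x =>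
    fderivWithin ℝ (fun z : EuclideanSpace ℝ (Fin n) × ℝ => v z.1 z.2) (closure Ω ×ˢ J) (x, t) (0, 1)
  have hTc : ContinuousOn T (closure Ω) :=
    (((hvf.fderivWithin hDu (m := 0) (by simp)).continuousOn).comp (by fun_prop)
      fun x hx => ⟨hx, ht⟩).clm_apply continuousOn_const
  have hTeq : ∀ x ∈ Ω, timeDeriv v x t = T x := by
    intro x hx
    have h1 := (hvf.differentiableOn (by simp) (x, t) ⟨subset_closure hx, ht⟩).hasFDerivWithinAt
    have h2 := h1.comp_hasDerivWithinAt (s := J) t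
      ((hasDerivAt_const t x).prodMk (hasDerivAt_id t)).hasDerivWithinAt
      fun s hs => ⟨subset_closure hx, hs⟩
    exact (h2.mono_of_mem_nhdsWithin hJt).derivWithin (uniqueDiffOn_Ici (0 : ℝ) t ht0)
  have hvt := hvs.slice ht
  have hut := hu₀.smooth.slice (mem_Ici.2 ht0)
  obtain ⟨L, hLc, hL⟩ := (hvt.of_le ENat.LEInfty.out).exists_continuousOn_laplacian hclu
  have hint : ∀ x ∈ Ω, closure Ω ∈ 𝓝 x := fun x hx =>
    mem_of_superset (hΩ.mem_nhds hx) subset_closure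
  let G : EuclideanSpace ℝ (Fin n) → EuclideanSpace ℝ (Fin n) := fun x =>
    (InnerProductSpace.toDual ℝ (EuclideanSpace ℝ (Fin n))).symm (spaceDifferential Ω u₀ x t)
  have hGc : ContinuousOn G (closure Ω) :=
    (LinearIsometryEquiv.continuous _).comp_continuousOn
      (hut.fderivWithin hclu (m := 0) (by simp)).continuousOn
  have hDc : ContinuousOn (fun x => spaceDifferential Ω v x t) (closure Ω) :=
    (hvt.fderivWithin hclu (m := 0) (by simp)).continuousOn
  have hid : ∀ x ∈ Ω, u₀ x t * (T x - L x) = 2 * spaceDifferential Ω v x t (G x) := by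
    intro x hx
    have h := quotient_identity hΩ hu₀ hu₁ hpos hv hx ht0
    have h1 : spaceLaplacian v x t = L x := hL x (mem_interior_iff_mem_nhds.2 (hint x hx))
    have h2 : spaceGradient u₀ x t = G x := by
      simp only [G, spaceGradient, gradient, spaceDifferential, fderivWithin_of_mem_nhds (hint x hx)]
    rw [hTeq x hx, h1, real_inner_comm, spaceGradient, inner_gradient_left, h2,
      ← fderivWithin_of_mem_nhds (hint x hx)] at h
    exact h
  have : (𝓝[Ω] p).NeBot := mem_closure_iff_nhdsWithin_neBot.1 hp.1
  have hlim : u₀ p t * (T p - L p) = 2 * spaceDifferential Ω v p t (G p) := by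
    have hl := ((hut.continuousOn.mul (hTc.sub hLc)) p hp.1).mono subset_closure
    have hr := ((continuousOn_const (c := (2 : ℝ))).mul (hDc.clm_apply hGc) p hp.1).mono
      subset_closure
    refine tendsto_nhds_unique hl (Tendsto.congr' ?_ hr)
    filter_upwards [self_mem_nhdsWithin] with x hx using (hid x hx).symm
  rw [hu₀.dirichlet p hp t ht0, zero_mul] at hlim
  obtain ⟨c, hc⟩ := hν.exists_eq_smul_innerSL hΩ hp
    ((hut.differentiableOn (by simp) p hp.1).hasFDerivWithinAt) (hu₀.dirichlet p hp t ht0)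
    fun x hx => (hpos x hx t ht0).le
  change spaceDifferential Ω u₀ p t = _ at hc
  have hc0 : c ≠ 0 := fun h => hne (by rw [hc, h, zero_smul])
  have hGp : G p = c • ν := by
    simp only [G]
    rw [LinearIsometryEquiv.symm_apply_eq, hc, map_smul]
    rfl
  rw [hGp, map_smul, smul_eq_mul] at hlim
  simpa [hc0] using hlim.symm

lemma isSmoothNeumann_quotientExtension (hΩ : IsOpen Ω) (hconv : Convex ℝ Ω)
    (hsmooth : HasSmoothBoundary Ω) (hu₀ : IsSchrodingerSolution Ω V u₀)
    (hu₁ : IsSchrodingerSolution Ω V u₁) (hpos : ∀ x ∈ Ω, ∀ t ≥ 0, 0 < u₀ x t)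
    {J : Set ℝ} (hJ : J ⊆ Ici 0) (hJu : UniqueDiffOn ℝ J) (hJn : ∀ t ∈ J, J ∈ 𝓝[Ici 0] t)
    (hne : ∀ x ∈ frontier Ω, ∀ t ∈ J, spaceDifferential Ω u₀ x t ≠ 0) :
    IsSmoothNeumann Ω J (quotientExtension Ω u₁ u₀) := by
  have hv : ∀ x ∈ Ω, ∀ t ≥ 0, quotientExtension Ω u₁ u₀ x t = u₁ x t / u₀ x t :=
    fun x hx t _ => quotientExtension_of_mem hx t
  have hvs : SmoothOn (quotientExtension Ω u₁ u₀) (closure Ω ×ˢ J) := by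
    rintro ⟨x, t⟩ ⟨hx, ht⟩
    by_cases hxΩ : x ∈ Ω
    · have hΩs := smoothOn_of_eq_div hu₀.smooth hu₁.smooth hpos hv
      refine ContDiffWithinAt.mono_of_mem_nhdsWithin (hΩs (x, t) ⟨hxΩ, hJ ht⟩) ?_
      rw [nhdsWithin_prod_eq]
      exact prod_mem_prod (mem_nhdsWithin_of_mem_nhds (hΩ.mem_nhds hxΩ))
        (mem_of_superset self_mem_nhdsWithin hJ)
    · have hxf : x ∈ frontier Ω := by rw [hΩ.frontier_eq]; exact ⟨hx, hxΩ⟩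
      exact (contDiffWithinAt_quotientExtension hΩ hconv hsmooth hu₀ hu₁ hpos hxf (hJ ht)
        (hne x hxf t ht)).mono (prod_mono Subset.rfl hJ)
  exact ⟨hvs, fun x hx t ht ν hν => spaceDifferential_normal_eq_zero hΩ hconv hu₀ hu₁ hpos hv hJ hJu
    hvs hx ht (hJn t ht) (hne x hx t ht) hν⟩
end

theorem proposition3p1 {n : ℕ} (Ω : Set (EuclideanSpace ℝ (Fin n)))
    (hΩ : IsSmoothStrictlyConvexDomain Ω)
    (V : EuclideanSpace ℝ (Fin n) → ℝ) (hV : ContDiffOn ℝ ∞ V (closure Ω))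
    (u₀ u₁ : EuclideanSpace ℝ (Fin n) → ℝ → ℝ)
    (hu₀ : IsSchrodingerSolution Ω V u₀) (hu₁ : IsSchrodingerSolution Ω V u₁)
    (hpos : ∀ x ∈ Ω, ∀ t ≥ 0, 0 < u₀ x t) :
    ∃ v : EuclideanSpace ℝ (Fin n) → ℝ → ℝ,
      (∀ x ∈ Ω, ∀ t ≥ 0, v x t = u₁ x t / u₀ x t) ∧
      SmoothOn v (Ω ×ˢ Ici 0) ∧
      (∀ x ∈ Ω, ∀ t ≥ 0,
        timeDeriv v x t - spaceLaplacian v x t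
          - 2 * inner ℝ (spaceGradient (fun y s => Real.log (u₀ y s)) x t)
              (spaceGradient v x t) = 0) ∧
      IsSmoothNeumann Ω (Ioi 0) v ∧
      ((∀ x ∈ frontier Ω, spaceDifferential Ω u₀ x 0 ≠ 0) → IsSmoothNeumann Ω (Ici 0) v) := by
  have hv : ∀ x ∈ Ω, ∀ t ≥ 0, quotientExtension Ω u₁ u₀ x t = u₁ x t / u₀ x t :=
    fun x hx t _ => quotientExtension_of_mem hx t
  have hHopf : ∀ x ∈ frontier Ω, ∀ t > 0, spaceDifferential Ω u₀ x t ≠ 0 := fun x hx t ht =>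
    hu₀.spaceDifferential_ne_zero hΩ.isOpen hΩ.isBounded hΩ.smoothBoundary hV.continuousOn hpos hx ht
  refine ⟨quotientExtension Ω u₁ u₀, hv, smoothOn_of_eq_div hu₀.smooth hu₁.smooth hpos hv,
    fun x hx t ht => quotient_equation hΩ.isOpen hu₀ hu₁ hpos hv hx ht, ?_, fun h0 => ?_⟩
  · exact isSmoothNeumann_quotientExtension hΩ.isOpen hΩ.convex hΩ.smoothBoundary hu₀ hu₁ hpos
      Ioi_subset_Ici_self (uniqueDiffOn_Ioi 0)
      (fun t ht => mem_nhdsWithin_of_mem_nhds (Ioi_mem_nhds ht)) hHopf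
  · refine isSmoothNeumann_quotientExtension hΩ.isOpen hΩ.convex hΩ.smoothBoundary hu₀ hu₁ hpos
      Subset.rfl (uniqueDiffOn_Ici 0) (fun t _ => self_mem_nhdsWithin) fun x hx t ht => ?_
    rcases (mem_Ici.1 ht).eq_or_lt with rfl | hlt
    · exact h0 x hx
    · exact hHopf x hx t hlt
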